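/- Let $k$ be an algebraically closed field of characteristic $p>0$ and let $G$ be a finite group of order $p^n$. Then $G$ acts freely, by automorphisms of varieties, on the affine space $\mathbf{A}\cong k^{|G|-1}$ in such a way that the following hold: 1. The quotient space $\mathbf{A}/G$ is isomorphic, as a variety, to the affine space $k^{|G|-1}$. 2. There is a (not necessarily linear) decomposition $\mathbf{A}=\mathbf{B}\times\mathbf{C}$, i.e. a $G$-equivariant isomorphism of varieties $\mathbf{A}\cong\mathbf{B}\times\mathbf{C}$, such that $G$ acts freely on $\mathbf{B}\cong k^n$ by automorphisms of varieties and trivially on $\mathbf{C}\cong k^{|G|-n-1}$. 3. The quotient space $\mathbf{B}/G$ is isomorphic, as a variety, to the affine space $k^n$. Here an action is free if every non-identity element of $G$ moves every (closed) point, and $X/G$ denotes the space of $G$-orbits of $X$ with ring of regular functions $k[X/G]=k[X]^G$. -/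

import Mathlib

/-- A space with functions over `k`: a set `X` together with a `k`-algebra of `k`-valued functions
on it, the regular functions. Over an algebraically closed field an affine variety is the set of its
closed points together with its ring of regular functions, and this pair determines everything else
(for instance the Zariski topology and the structure sheaf). -/
class SpaceWithFunctions (k : Type*) [CommSemiring k] (X : Type*) where
  /-- The algebra `k[X]` of regular functions. -/
  regular : Subalgebra k (X → k)

namespace SpaceWithFunctions

/-- A morphism pulls regular functions back to regular functions. -/
def IsMorphism (k : Type*) [CommSemiring k] {X Y : Type*} [SpaceWithFunctions k X]
    [SpaceWithFunctions k Y] (φ : X → Y) : Prop :=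
  ∀ f ∈ regular (k := k) (X := Y), f ∘ φ ∈ regular (k := k) (X := X)

/-- An isomorphism is a bijection which is a morphism in both directions. -/
structure Iso (k : Type*) [CommSemiring k] (X Y : Type*) [SpaceWithFunctions k X]
    [SpaceWithFunctions k Y] extends X ≃ Y where
  isMorphism_toFun : IsMorphism k toFun
  isMorphism_invFun : IsMorphism k invFun

/-- Affine space `k^m`; its regular functions are the polynomial functions. -/
abbrev AffSpace (k : Type*) (m : ℕ) : Type _ := Fin m → k

instance affSpace (k : Type*) [CommSemiring k] (m : ℕ) : SpaceWithFunctions k (AffSpace k m) where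
  regular := Algebra.adjoin k (Set.range fun (i : Fin m) (x : AffSpace k m) => x i)

/-- The product of affine varieties: `k[X × Y]` is generated by `k[X]` and `k[Y]`. -/
instance prod (k : Type*) [CommSemiring k] (X Y : Type*) [SpaceWithFunctions k X]
    [SpaceWithFunctions k Y] : SpaceWithFunctions k (X × Y) where
  regular := Algebra.adjoin k
    ((fun (f : X → k) (z : X × Y) => f z.1) '' (regular (k := k) (X := X)) ∪
      (fun (f : Y → k) (z : X × Y) => f z.2) '' (regular (k := k) (X := Y)))

/-- The quotient space `X/G`: the set of orbits, with `k[X/G] = k[X]^G`, that is, a function on the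
set of orbits is regular if and only if its pull-back to `X` is regular. -/
instance quotient (k : Type*) [CommSemiring k] (G X : Type*) [Group G] [MulAction G X]
    [SpaceWithFunctions k X] : SpaceWithFunctions k (MulAction.orbitRel.Quotient G X) where
  regular :=
    { carrier := {f | (fun x : X => f (Quotient.mk (MulAction.orbitRel G X) x)) ∈
        regular (k := k) (X := X)}
      mul_mem' := fun ha hb => (regular (k := k) (X := X)).mul_mem ha hb
      add_mem' := fun ha hb => (regular (k := k) (X := X)).add_mem ha hb
      algebraMap_mem' := fun r => (regular (k := k) (X := X)).algebraMap_mem r }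

/-- `G` acts on the variety `X` by automorphisms of varieties. -/
def IsRegularAction (k : Type*) [CommSemiring k] (G X : Type*) [Group G] [MulAction G X]
    [SpaceWithFunctions k X] : Prop :=
  ∀ g : G, IsMorphism k (fun x : X => g • x)

/-- The action of `G` on `X` is free: all stabilizers are trivial. -/
def IsFreeAction (G X : Type*) [Group G] [MulAction G X] : Prop :=
  ∀ (g : G) (x : X), g • x = x → g = 1

end SpaceWithFunctions

/-! Induct on `n`, writing `G` as a central extension of `Q`, of order `p ^ (n - 1)`, by `ZMod p`.
Carry along a quotient map `π : X → Y` together with the fact that the trace sends `k[X]` into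
`k[Y]` and takes the value 1 at some `w` (`IsGaloisQuotient`). An invariant `f` is then the trace of
`w * f`, so `k[Y]` is all of `k[X]^Q`.

The element `w` also kills the cohomology of `Q` in `k[X]`. Hence the extension class dies there:
some cocycle `c : G → k[X]` restricts to the inclusion of `ZMod p` in `k` (`exists_cocycle`), and
`G` acts freely on `X × k` by `(x, t) ↦ (gx, t + c g x)`. Since `c ^ p - c` vanishes on `ZMod p`, it
comes from `Q` and is the coboundary of some `v` (`exists_coboundary`). So `θ = t ^ p - t - v` is
invariant, and `(π, θ)` is the new quotient map by Artin–Schreier theory: the fibres of `t ↦ t ^ p -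
t` are `ZMod p`-torsors. The trace conditions survive by power sums over `ZMod p`
(`sum_add_zmod_pow`).

This produces `B`; then `A` is `B × C` with trivial action on `C`. -/

namespace SpaceWithFunctions

/-! ### Morphisms, products and affine spaces -/

theorem isMorphism_affSpace {k X : Type*} [CommSemiring k] [SpaceWithFunctions k X] {m : ℕ}
    {φ : X → AffSpace k m}
    (h : ∀ i, (fun x => φ x i) ∈ regular (k := k) (X := X)) : IsMorphism k φ := by
  intro f hf
  induction hf using Algebra.adjoin_induction with
  | mem f hf => obtain ⟨i, rfl⟩ := hf; exact h i
  | algebraMap r => exact (regular (k := k) (X := X)).algebraMap_mem r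
  | add f g _ _ hf hg => exact add_mem hf hg
  | mul f g _ _ hf hg => exact mul_mem hf hg

theorem coord_mem_regular (k : Type*) [CommSemiring k] {m : ℕ} (i : Fin m) :
    (fun x : AffSpace k m => x i) ∈ regular (k := k) (X := AffSpace k m) :=
  Algebra.subset_adjoin ⟨i, rfl⟩

theorem const_mem_regular {k : Type*} (X : Type*) [CommSemiring k] [SpaceWithFunctions k X]
    (r : k) : (fun _ => r) ∈ regular (k := k) (X := X) :=
  (regular (k := k) (X := X)).algebraMap_mem r

section Prod

variable {k X Y Z : Type*} [CommSemiring k] [SpaceWithFunctions k X] [SpaceWithFunctions k Y]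
  [SpaceWithFunctions k Z]

theorem IsMorphism.comp {ψ : Y → Z} {φ : X → Y} (hψ : IsMorphism k ψ) (hφ : IsMorphism k φ) :
    IsMorphism k (fun x => ψ (φ x)) :=
  fun f hf => hφ _ (hψ f hf)

theorem isMorphism_id : IsMorphism k (fun x : X => x) := fun _ hf => hf

theorem isMorphism_fst : IsMorphism k (Prod.fst : X × Y → X) :=
  fun f hf => Algebra.subset_adjoin (Or.inl ⟨f, hf, rfl⟩)

theorem isMorphism_snd : IsMorphism k (Prod.snd : X × Y → Y) :=
  fun f hf => Algebra.subset_adjoin (Or.inr ⟨f, hf, rfl⟩)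

theorem IsMorphism.prodMk {φ : Z → X} {ψ : Z → Y} (hφ : IsMorphism k φ) (hψ : IsMorphism k ψ) :
    IsMorphism k (fun z => (φ z, ψ z)) := by
  intro f hf
  induction hf using Algebra.adjoin_induction with
  | mem f hf =>
    rcases hf with ⟨f, hf, rfl⟩ | ⟨f, hf, rfl⟩
    · exact hφ f hf
    · exact hψ f hf
  | algebraMap r => exact (regular (k := k) (X := Z)).algebraMap_mem r
  | add f g _ _ hf hg => exact add_mem hf hg
  | mul f g _ _ hf hg => exact mul_mem hf hg

/-- The regular functions on a product are the sums of products of regular functions on the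
factors. -/
theorem regular_prod_induction {P : (X × Y → k) → Prop}
    (hmul : ∀ a ∈ regular (k := k) (X := X), ∀ b ∈ regular (k := k) (X := Y),
      P fun z => a z.1 * b z.2)
    (hadd : ∀ f g, P f → P g → P (f + g)) {f : X × Y → k}
    (hf : f ∈ regular (k := k) (X := X × Y)) : P f := by
  have hf' : f ∈ Subalgebra.toSubmodule (regular (k := k) (X := X × Y)) := hf
  change f ∈ Subalgebra.toSubmodule (Algebra.adjoin k _) at hf'
  rw [Algebra.adjoin_eq_span] at hf'
  have key : ∀ g ∈ Submonoid.closure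
      ((fun (f : X → k) (z : X × Y) => f z.1) '' (regular (k := k) (X := X)) ∪
      (fun (f : Y → k) (z : X × Y) => f z.2) '' (regular (k := k) (X := Y))),
      ∃ a ∈ regular (k := k) (X := X), ∃ b ∈ regular (k := k) (X := Y),
        g = fun z => a z.1 * b z.2 := by
    intro g hg
    induction hg using Submonoid.closure_induction with
    | mem g hg =>
      rcases hg with ⟨a, ha, rfl⟩ | ⟨b, hb, rfl⟩
      · exact ⟨a, ha, 1, one_mem _, by ext; simp⟩
      · exact ⟨1, one_mem _, b, hb, by ext; simp⟩
    | one => exact ⟨1, one_mem _, 1, one_mem _, by ext; simp⟩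
    | mul f g _ _ hf hg =>
      obtain ⟨a, ha, b, hb, rfl⟩ := hf
      obtain ⟨a', ha', b', hb', rfl⟩ := hg
      exact ⟨a * a', mul_mem ha ha', b * b', mul_mem hb hb', by
        ext; simp only [Pi.mul_apply]; ring⟩
  -- `P` is not assumed stable under scalars, so the span induction runs over all multiples of `f`
  -- at once.
  have : ∀ r : k, P (r • f) := by
    clear hf
    induction hf' using Submodule.span_induction with
    | mem g hg =>
      intro r
      obtain ⟨a, ha, b, hb, rfl⟩ := key g hg
      convert hmul (r • a) (Subalgebra.smul_mem _ ha r) b hb using 1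
      ext; simp [mul_assoc]
    | zero =>
      intro r
      convert hmul 0 (zero_mem _) 0 (zero_mem _) using 1
      ext; simp
    | add f g _ _ hf hg =>
      intro r
      rw [smul_add]
      exact hadd _ _ (hf r) (hg r)
    | smul s f _ hf =>
      intro r
      rw [smul_smul]
      exact hf (r * s)
  simpa using this 1

theorem regular_affSpace_one_induction {P : (AffSpace k 1 → k) → Prop}
    (hpow : ∀ (r : k) (i : ℕ), P fun t => r * t 0 ^ i)
    (hadd : ∀ f g, P f → P g → P (f + g)) {f : AffSpace k 1 → k}
    (hf : f ∈ regular (k := k) (X := AffSpace k 1)) : P f := by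
  have hf' : f ∈ Algebra.adjoin k {fun x : AffSpace k 1 => x 0} := by
    have : (Set.range fun (i : Fin 1) (x : AffSpace k 1) => x i)
        = {fun x : AffSpace k 1 => x 0} := by
      ext f; simp [Set.mem_range, eq_comm, Fin.exists_fin_one]
    rw [← this]; exact hf
  rw [Algebra.adjoin_singleton_eq_range_aeval] at hf'
  obtain ⟨q, rfl⟩ := hf'
  change P (Polynomial.aeval (fun x : AffSpace k 1 => x 0) q)
  clear hf
  induction q using Polynomial.induction_on' with
  | add p q hp hq => rw [map_add]; exact hadd _ _ hp hq
  | monomial i r =>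
    convert hpow r i using 1
    ext t
    simp [Polynomial.aeval_monomial]

end Prod

/-- `k^m × k^l ≅ k^N` when `m + l = N`. -/
def affSpaceProdIso (k : Type*) [CommSemiring k] {m l N : ℕ} (h : m + l = N) :
    Iso k (AffSpace k N) (AffSpace k m × AffSpace k l) where
  toFun x := (fun i => x (Fin.cast h (Fin.castAdd l i)), fun i => x (Fin.cast h (Fin.natAdd m i)))
  invFun z := fun i => Fin.addCases z.1 z.2 (Fin.cast h.symm i)
  left_inv x := by
    subst h
    ext i
    refine Fin.addCases (fun j => ?_) (fun j => ?_) i <;> simp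
  right_inv z := by
    subst h
    ext i <;> simp
  isMorphism_toFun :=
    IsMorphism.prodMk (isMorphism_affSpace fun _ => coord_mem_regular k _)
      (isMorphism_affSpace fun _ => coord_mem_regular k _)
  isMorphism_invFun := by
    subst h
    refine isMorphism_affSpace fun i => ?_
    refine Fin.addCases (fun j => ?_) (fun j => ?_) i
    · simpa [Function.comp_def] using isMorphism_fst _ (coord_mem_regular k j)
    · simpa [Function.comp_def] using isMorphism_snd _ (coord_mem_regular k j)

/-- The inverse isomorphism. -/
def Iso.symm {k X Y : Type*} [CommSemiring k] [SpaceWithFunctions k X] [SpaceWithFunctions k Y]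
    (e : Iso k X Y) : Iso k Y X where
  toEquiv := e.toEquiv.symm
  isMorphism_toFun := e.isMorphism_invFun
  isMorphism_invFun := e.isMorphism_toFun

/-! ### Quotients by free actions with a trace-one function -/

/-- A free action of a finite group `G` on `X` with quotient map `π : X → Y`, such that the trace
`k[X] → k[X]^G = k[Y]` is defined and hits `1`. -/
structure IsGaloisQuotient (k G : Type*) {X Y : Type*} [CommSemiring k] [Group G] [Fintype G]
    [MulAction G X] [SpaceWithFunctions k X] [SpaceWithFunctions k Y] (π : X → Y) : Prop where
  isRegularAction : IsRegularAction k G X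
  isFreeAction : IsFreeAction G X
  surjective : Function.Surjective π
  eq_iff : ∀ x y, π x = π y ↔ ∃ g : G, g • x = y
  isMorphism : IsMorphism k π
  exists_trace_eq_one : ∃ w ∈ regular (k := k) (X := X), ∀ x, ∑ g : G, w (g • x) = 1
  exists_trace_eq : ∀ f ∈ regular (k := k) (X := X), ∃ F ∈ regular (k := k) (X := Y),
    ∀ x, ∑ g : G, f (g • x) = F (π x)

namespace IsGaloisQuotient

variable {k G X Y : Type*} [CommSemiring k] [Group G] [Fintype G]
  [MulAction G X] [SpaceWithFunctions k X] [SpaceWithFunctions k Y] {π : X → Y}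

theorem map_smul (h : IsGaloisQuotient k G π) (g : G) (x : X) : π (g • x) = π x :=
  ((h.eq_iff x _).2 ⟨g, rfl⟩).symm

/-- The pull-back of `F` is invariant, hence comes out of the trace: the trace of `w * (F ∘ π)` is
`F ∘ π`, and traces descend to regular functions on `Y`. -/
theorem mem_regular_of_comp (h : IsGaloisQuotient k G π) {F : Y → k}
    (hF : (fun x => F (π x)) ∈ regular (k := k) (X := X)) : F ∈ regular (k := k) (X := Y) := by
  obtain ⟨w, hw, hw1⟩ := h.exists_trace_eq_one
  obtain ⟨H, hH, hH'⟩ := h.exists_trace_eq _ (mul_mem hw hF)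
  convert hH
  ext y
  obtain ⟨x, rfl⟩ := h.surjective y
  rw [← hH' x]
  simp [h.map_smul, ← Finset.sum_mul, hw1]

/-- The orbit space is isomorphic to the target of a Galois quotient map. -/
theorem nonempty_iso (h : IsGaloisQuotient k G π) :
    Nonempty (Iso k (MulAction.orbitRel.Quotient G X) Y) := by
  let φ : MulAction.orbitRel.Quotient G X → Y := Quotient.lift π (by
    rintro a b ⟨g, rfl⟩
    exact h.map_smul g b)
  have hφ : Function.Bijective φ := by
    constructor
    · rintro ⟨a⟩ ⟨b⟩ hab
      obtain ⟨g, hg⟩ := (h.eq_iff b a).1 (Eq.symm hab)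
      exact Quotient.sound ⟨g, hg⟩
    · intro y
      obtain ⟨x, rfl⟩ := h.surjective y
      exact ⟨Quotient.mk _ x, rfl⟩
  refine ⟨{ Equiv.ofBijective φ hφ with
    isMorphism_toFun := fun F hF => h.isMorphism F hF
    isMorphism_invFun := fun f hf => h.mem_regular_of_comp ?_ }⟩
  have hf' : (fun x => f (Quotient.mk _ x)) ∈ regular (k := k) (X := X) := hf
  convert hf' using 2 with x
  exact congrArg f ((Equiv.ofBijective φ hφ).symm_apply_apply (Quotient.mk _ x))

/-- Transport of a Galois quotient along isomorphisms of source and target. -/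
theorem transport {X' Y' : Type*} [SpaceWithFunctions k X'] [SpaceWithFunctions k Y']
    (h : IsGaloisQuotient k G π) (e : Iso k X' X) (e' : Iso k Y Y') [MulAction G X']
    (he : ∀ (g : G) (x : X'), e.toEquiv (g • x) = g • e.toEquiv x) :
    IsGaloisQuotient k G (fun x => e'.toEquiv (π (e.toEquiv x))) where
  isRegularAction g := by
    have : (fun x : X' => g • x) = fun x => e.toEquiv.symm (g • e.toEquiv x) := by
      ext x; rw [← he, Equiv.symm_apply_apply]
    rw [this]
    exact IsMorphism.comp e.isMorphism_invFun
      (IsMorphism.comp (h.isRegularAction g) e.isMorphism_toFun)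
  isFreeAction g x hx := h.isFreeAction g (e.toEquiv x) (by rw [← he, hx])
  surjective := e'.toEquiv.surjective.comp (h.surjective.comp e.toEquiv.surjective)
  eq_iff x y := by
    simp only [EmbeddingLike.apply_eq_iff_eq, h.eq_iff, ← he]
  isMorphism := IsMorphism.comp e'.isMorphism_toFun (IsMorphism.comp h.isMorphism e.isMorphism_toFun)
  exists_trace_eq_one := by
    obtain ⟨w, hw, hw1⟩ := h.exists_trace_eq_one
    refine ⟨_, e.isMorphism_toFun w hw, fun x => ?_⟩
    have := hw1 (e.toEquiv x)
    simp only [← he] at this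
    exact this
  exists_trace_eq f hf := by
    obtain ⟨F, hF, hF'⟩ := h.exists_trace_eq _ (e.isMorphism_invFun f hf)
    refine ⟨_, e'.isMorphism_invFun F hF, fun x => ?_⟩
    have := hF' (e.toEquiv x)
    simp only [← he, Function.comp_apply] at this
    have h1 : ∀ y, e.invFun (e.toEquiv y) = y := e.toEquiv.symm_apply_apply
    have h2 : ∀ y, e'.invFun (e'.toEquiv y) = y := e'.toEquiv.symm_apply_apply
    simp only [h1] at this
    simpa only [Function.comp_apply, h2] using this

/-- The product of a Galois quotient with a space on which the group acts trivially. -/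
theorem prod_trivial {C : Type*} [SpaceWithFunctions k C] [MulAction G C]
    (h : IsGaloisQuotient k G π) (hC : ∀ (g : G) (c : C), g • c = c) :
    IsGaloisQuotient k G (fun z : X × C => (π z.1, z.2)) where
  isRegularAction g := by
    have : (fun z : X × C => g • z) = fun z => (g • z.1, z.2) := by
      ext z <;> simp [hC]
    rw [this]
    exact ((h.isRegularAction g).comp isMorphism_fst).prodMk isMorphism_snd
  isFreeAction g z hz := h.isFreeAction g z.1 (congrArg Prod.fst hz)
  surjective := by
    rintro ⟨y, c⟩
    obtain ⟨x, rfl⟩ := h.surjective y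
    exact ⟨(x, c), rfl⟩
  eq_iff := by
    rintro ⟨x, c⟩ ⟨x', c'⟩
    simp only [Prod.mk.injEq, Prod.smul_mk, h.eq_iff, hC]
    constructor
    · rintro ⟨⟨g, hg⟩, hc⟩; exact ⟨g, hg, hc⟩
    · rintro ⟨g, hg, hc⟩; exact ⟨⟨g, hg⟩, hc⟩
  isMorphism := (h.isMorphism.comp isMorphism_fst).prodMk isMorphism_snd
  exists_trace_eq_one := by
    obtain ⟨w, hw, hw1⟩ := h.exists_trace_eq_one
    exact ⟨_, isMorphism_fst w hw, fun z => hw1 z.1⟩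
  exists_trace_eq f hf := by
    -- The trace is additive and linear over `k[C]`, so products `a(x) * b(c)` suffice.
    refine regular_prod_induction (P := fun f => ∃ F ∈ regular (k := k) (X := Y × C),
      ∀ z, ∑ g : G, f (g • z) = F (π z.1, z.2)) (fun a ha b hb => ?_) (fun f g hf hg => ?_) hf
    · obtain ⟨F, hF, hF'⟩ := h.exists_trace_eq a ha
      refine ⟨_, mul_mem (isMorphism_fst F hF) (isMorphism_snd b hb), fun z => ?_⟩
      simp [hC, ← Finset.sum_mul, hF']
    · obtain ⟨F, hF, hF'⟩ := hf
      obtain ⟨H, hH, hH'⟩ := hg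
      refine ⟨_, add_mem hF hH, fun z => ?_⟩
      simp [Finset.sum_add_distrib, hF', hH']

end IsGaloisQuotient

/-! ### Central extensions by `ZMod p` and power sums -/

/-- A central extension of `Q` by `ZMod p`, together with a normalized section `s` and the induced
coordinate `coord` on `G`. -/
structure CentralExtension (p : ℕ) (G Q : Type*) [Group G] [Group Q] where
  proj : G →* Q
  incl : ZMod p → G
  sec : Q → G
  coord : G → ZMod p
  proj_section : ∀ q, proj (sec q) = q
  proj_incl : ∀ z, proj (incl z) = 1
  eq_section_mul : ∀ g, g = sec (proj g) * incl (coord g)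
  coord_section : ∀ q, coord (sec q) = 0
  coord_mul_incl : ∀ g z, coord (g * incl z) = coord g + z
  incl_comm : ∀ g z, g * incl z = incl z * g
  exists_incl_eq : ∀ g, proj g = 1 → ∃ z, incl z = g

/-- A non-trivial finite `p`-group is a central extension by `ZMod p`. -/
theorem exists_centralExtension (p n : ℕ) [hp : Fact p.Prime] (G : Type*) [Group G]
    (hG : Nat.card G = p ^ (n + 1)) :
    ∃ N : Subgroup G, ∃ _ : N.Normal, Nat.card (G ⧸ N) = p ^ n ∧
      Nonempty (CentralExtension p G (G ⧸ N)) := by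
  have hfin : Finite G := Nat.finite_of_card_ne_zero (by
    rw [hG]; exact pow_ne_zero _ hp.out.ne_zero)
  have hpG : IsPGroup p G := IsPGroup.of_card hG
  have : Nontrivial G := (Finite.one_lt_card_iff_nontrivial).1 (by
    rw [hG]; exact Nat.one_lt_pow (Nat.succ_ne_zero n) hp.out.one_lt)
  have := hpG.center_nontrivial
  obtain ⟨a, ha⟩ : ∃ a : Subgroup.center G, orderOf a = p := by
    refine exists_prime_orderOf_dvd_card' p ?_
    obtain ⟨m, hm, hm'⟩ := (hpG.to_subgroup (Subgroup.center G)).nontrivial_iff_card.1 this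
    rw [hm']
    exact dvd_pow_self p hm.ne'
  have hcomm : ∀ (g : G) (m : ℕ), g * (a : G) ^ m = (a : G) ^ m * g := fun g m =>
    (Subgroup.mem_center_iff.1 (pow_mem a.2 m) g)
  have ha' : orderOf (a : G) = p := by rw [Subgroup.orderOf_coe, ha]
  -- The kernel is generated by a central element of order `p`, which exists because the center of a
  -- non-trivial `p`-group is non-trivial.
  let N := Subgroup.zpowers (a : G)
  have hN : N.Normal := ⟨by
    intro x hx g
    have hx' : x ∈ Subgroup.center G := (Subgroup.zpowers_le.2 a.2) hx
    rwa [Subgroup.mem_center_iff.1 hx' g, mul_inv_cancel_right]⟩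
  refine ⟨N, hN, ?_, ?_⟩
  · have h1 := Subgroup.card_eq_card_quotient_mul_card_subgroup N
    rw [hG, Nat.card_zpowers, ha', pow_succ] at h1
    exact (Nat.eq_of_mul_eq_mul_right hp.out.pos h1).symm
  · let incl : ZMod p → G := fun z => (a : G) ^ z.val
    have incl_add : ∀ y z, incl (y + z) = incl y * incl z := fun y z => by
      simp only [incl]
      rw [← pow_add, ZMod.val_add, ← pow_mod_orderOf (a : G) (y.val + z.val), ha']
    have incl_inj : Function.Injective incl := by
      intro y z hyz
      have h1 : y.val ≡ z.val [MOD p] := by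
        have := pow_eq_pow_iff_modEq.1 hyz
        rwa [ha'] at this
      apply ZMod.val_injective
      rwa [Nat.ModEq, Nat.mod_eq_of_lt (ZMod.val_lt y), Nat.mod_eq_of_lt (ZMod.val_lt z)] at h1
    let s : G ⧸ N → G := Quotient.out
    have hs : ∀ q, (QuotientGroup.mk' N) (s q) = q := fun q => Quotient.out_eq q
    have hker : ∀ g ∈ N, ∃ z, incl z = g := by
      intro g hg
      obtain ⟨m, hm⟩ := mem_powers_iff_mem_zpowers.2 hg
      refine ⟨(m : ZMod p), ?_⟩
      have : (a : G) ^ (m % p) = g := by rw [← hm, ← ha']; exact pow_mod_orderOf _ _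
      simpa only [incl, ZMod.val_natCast] using this
    have hex : ∀ g : G, ∃ z, s (QuotientGroup.mk' N g) * incl z = g := by
      intro g
      have : (s (QuotientGroup.mk' N g))⁻¹ * g ∈ N := by
        rw [← QuotientGroup.eq]; exact hs _
      obtain ⟨z, hz⟩ := hker _ this
      exact ⟨z, by rw [hz, mul_inv_cancel_left]⟩
    choose coord hcoord using hex
    have hproj : ∀ z, QuotientGroup.mk' N (incl z) = 1 := fun z =>
      (QuotientGroup.eq_one_iff _).2 (pow_mem (Subgroup.mem_zpowers _) _)
    have hmul : ∀ g z, coord (g * incl z) = coord g + z := fun g z => by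
      apply incl_inj
      have h1 := hcoord (g * incl z)
      rw [map_mul, hproj, mul_one] at h1
      rw [incl_add]
      apply mul_left_cancel (a := s (QuotientGroup.mk' N g))
      rw [h1, ← mul_assoc, hcoord]
    refine ⟨⟨QuotientGroup.mk' N, incl, s, coord, hs, hproj, fun g => (hcoord g).symm,
      fun q => ?_, hmul, fun g z => hcomm g _,
      fun g hg => hker g ((QuotientGroup.eq_one_iff g).1 hg)⟩⟩
    apply incl_inj
    have h1 := hcoord (s q)
    rw [hs] at h1
    apply mul_left_cancel (a := s q)
    rw [h1]; simp [incl]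

/-- Expand binomially: power sums over `ZMod p` vanish in degrees below `p - 1` and equal -1 in
degree `p - 1`, so only the term free of `T` can survive. -/
theorem sum_add_zmod_pow {k : Type*} [Field k] (p : ℕ) [hp : Fact p.Prime] [CharP k p] (T : k)
    {i : ℕ} (hi : i < p) :
    ∑ z : ZMod p, (T + ZMod.castHom (dvd_refl p) k z) ^ i = if i = p - 1 then -1 else 0 := by
  have hlt : ∀ m < p - 1, ∑ z : ZMod p, (ZMod.castHom (dvd_refl p) k z) ^ m = 0 := fun m hm => by
    simp_rw [← map_pow]
    rw [← map_sum, FiniteField.sum_pow_lt_card_sub_one _ m (by rwa [ZMod.card]), map_zero]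
  have heq : ∑ z : ZMod p, (ZMod.castHom (dvd_refl p) k z) ^ (p - 1) = -1 := by
    have h1 : ∀ z : ZMod p, z ^ (p - 1) = if z = 0 then 0 else 1 := fun z => by
      split_ifs with h
      · rw [h, zero_pow]; have := hp.out.two_le; omega
      · exact ZMod.pow_card_sub_one_eq_one h
    have h2 : ∑ z : ZMod p, z ^ (p - 1) = -1 := by
      simp_rw [h1]
      have : ∀ z : ZMod p, (if z = 0 then (0 : ZMod p) else 1) = 1 - if z = 0 then 1 else 0 :=
        fun z => by split_ifs <;> simp
      simp [this, Finset.sum_sub_distrib, ZMod.card]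
    simp_rw [← map_pow]
    rw [← map_sum, h2]; simp
  simp_rw [add_pow]
  rw [Finset.sum_comm]
  simp_rw [← Finset.sum_mul, ← Finset.mul_sum]
  rw [Finset.sum_eq_single 0]
  · simp only [pow_zero, one_mul, Nat.sub_zero, Nat.choose_zero_right, Nat.cast_one, mul_one]
    split_ifs with h
    · rw [h, heq]
    · exact hlt i (by omega)
  · intro m hm hm0
    have := Finset.mem_range.1 hm
    rw [hlt (i - m) (by omega)]; simp
  · simp

namespace CentralExtension

variable {p : ℕ} {G Q : Type*} [Group G] [Group Q] (E : CentralExtension p G Q)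

/-- Centrality moves the `ZMod p` part of `x` past `g`. This is the source of the cocycle identity
in `exists_cocycle`. -/
theorem coord_mul (x g : G) :
    E.coord (x * g) = E.coord (E.sec (E.proj x) * g) + E.coord x := by
  conv_lhs => rw [E.eq_section_mul x]
  rw [mul_assoc, ← E.incl_comm, ← mul_assoc, E.coord_mul_incl]

theorem coord_incl_mul (q : Q) (z : ZMod p) : E.coord (E.sec q * E.incl z) = z := by
  rw [E.coord_mul_incl, E.coord_section, zero_add]

theorem incl_zero : E.incl 0 = 1 := by
  have h := E.eq_section_mul (E.sec 1)
  rw [E.proj_section, E.coord_section] at h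
  exact mul_eq_left.1 h.symm

/-- The bijection `G ≃ Q × ZMod p` given by the section. -/
def equiv : Q × ZMod p ≃ G where
  toFun x := E.sec x.1 * E.incl x.2
  invFun g := (E.proj g, E.coord g)
  left_inv x := by
    ext
    · simp [E.proj_section, E.proj_incl]
    · exact E.coord_incl_mul _ _
  right_inv g := (E.eq_section_mul g).symm

end CentralExtension

/-! ### Vanishing of cohomology in the regular functions -/

section Cocycle

variable {k : Type*} [Field k] {p : ℕ} {G Q X Y : Type*} [Group G]
  [Group Q] [Fintype Q] [MulAction Q X] [SpaceWithFunctions k X] [SpaceWithFunctions k Y]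
  {π : X → Y}

/-- The class of the extension dies in the regular functions: there is a cocycle
on `G` which restricts to the inclusion of `ZMod p`. -/
theorem IsGaloisQuotient.exists_cocycle [Fact p.Prime] [CharP k p] (h : IsGaloisQuotient k Q π)
    (E : CentralExtension p G Q) :
    ∃ c : G → X → k, (∀ g, c g ∈ regular (k := k) (X := X)) ∧
      (∀ g g' x, c (g * g') x = c g (E.proj g' • x) + c g' x) ∧
      ∀ z x, c (E.incl z) x = ZMod.castHom (dvd_refl p) k z := by
  obtain ⟨w, hw, hw1⟩ := h.exists_trace_eq_one
  -- An average of the coordinates of `sec q * g` with weights summing to 1. On `incl z` every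
  -- coordinate is `z`, so the average is `z`.
  refine ⟨fun g x => ∑ q : Q, w ((q * E.proj g) • x) *
    ZMod.castHom (dvd_refl p) k (E.coord (E.sec q * g)), fun g => ?_, fun g g' x => ?_,
    fun z x => ?_⟩
  · have := sum_mem (S := regular (k := k) (X := X)) (t := Finset.univ)
      (f := fun (q : Q) (x : X) => w ((q * E.proj g) • x) *
        ZMod.castHom (dvd_refl p) k (E.coord (E.sec q * g)))
      fun q _ => mul_mem (h.isRegularAction (q * E.proj g) w hw) (const_mem_regular X _)
    convert this using 1
    ext x; simp
  · have h1 : ∀ q : Q, E.coord (E.sec q * (g * g')) =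
        E.coord (E.sec (q * E.proj g) * g') + E.coord (E.sec q * g) := fun q => by
      rw [← mul_assoc, E.coord_mul, map_mul, E.proj_section]
    simp only [h1, map_add, mul_add, Finset.sum_add_distrib]
    rw [add_comm]
    congr 1
    · simp only [map_mul, smul_smul, mul_assoc]
    · exact Fintype.sum_equiv (Equiv.mulRight (E.proj g)) _ _ fun q => by
        simp [map_mul, mul_assoc]
  · simp only [E.proj_incl, mul_one, E.coord_incl_mul]
    rw [← Finset.sum_mul, hw1, one_mul]

/-- A cocycle of `G` which factors through `Q` is a coboundary. -/
theorem IsGaloisQuotient.exists_coboundary (h : IsGaloisQuotient k Q π)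
    (E : CentralExtension p G Q) (d : G → X → k) (hd : ∀ g, d g ∈ regular (k := k) (X := X))
    (hmul : ∀ g g' x, d (g * g') x = d g (E.proj g' • x) + d g' x)
    (hincl : ∀ z x, d (E.incl z) x = 0) :
    ∃ v ∈ regular (k := k) (X := X), ∀ g x, v (E.proj g • x) = v x + d g x := by
  obtain ⟨w, hw, hw1⟩ := h.exists_trace_eq_one
  have hsec : ∀ g x, d g x = d (E.sec (E.proj g)) x := fun g x => by
    conv_lhs => rw [E.eq_section_mul g]
    rw [hmul, hincl, add_zero, E.proj_incl, one_smul]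
  -- The usual contracting homotopy: average the cocycle over `Q` with weights `w (q • x)`.
  refine ⟨fun x => ∑ q : Q, -(w (q • x) * d (E.sec q) x), ?_, fun g x => ?_⟩
  · have := sum_mem (S := regular (k := k) (X := X)) (t := Finset.univ)
      (f := fun (q : Q) (x : X) => -(w (q • x) * d (E.sec q) x))
      fun q _ => neg_mem (mul_mem (h.isRegularAction q w hw) (hd _))
    convert this using 1
    ext x; simp
  · have h1 : ∀ q, d (E.sec q) (E.proj g • x) =
        d (E.sec (q * E.proj g)) x - d g x := fun q => by
      have h2 := hmul (E.sec q) g x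
      rw [hsec (E.sec q * g), map_mul, E.proj_section] at h2
      rw [h2]; ring
    simp only [h1, smul_smul, mul_sub, neg_sub, Finset.sum_sub_distrib, ← Finset.sum_mul]
    have h3 : ∀ F : Q → k, ∑ q, F (q * E.proj g) = ∑ q, F q := fun F =>
      Fintype.sum_equiv (Equiv.mulRight (E.proj g)) _ _ fun q => rfl
    rw [h3 fun q => w (q • x), h3 fun q => w (q • x) * d (E.sec q) x, hw1, one_mul,
      Finset.sum_neg_distrib]
    ring

end Cocycle

/-! ### The Artin–Schreier step -/

/-- The action of `G` on `X × k` twisted by a cocycle. -/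
@[reducible] def twistedAction {k G Q X : Type*} [Ring k] [Group G] [Group Q] [MulAction Q X]
    (ρ : G →* Q) (c : G → X → k) (hc : ∀ g g' x, c (g * g') x = c g (ρ g' • x) + c g' x) :
    MulAction G (X × AffSpace k 1) where
  smul g z := (ρ g • z.1, fun _ => z.2 0 + c g z.1)
  one_smul z := by
    have h := hc 1 1 z.1
    rw [mul_one, map_one, one_smul, left_eq_add] at h
    change (ρ 1 • z.1, fun _ => z.2 0 + c 1 z.1) = z
    ext i
    · simp
    · simp [h, Subsingleton.elim i 0]
  mul_smul g g' z := by
    change (ρ (g * g') • z.1, fun _ => z.2 0 + c (g * g') z.1) =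
      (ρ g • ρ g' • z.1, fun _ => (z.2 0 + c g' z.1) + c g (ρ g' • z.1))
    rw [hc, map_mul, mul_smul]
    congr 1
    ext
    abel

section Step

variable {k : Type*} [Field k] [IsAlgClosed k] {p : ℕ} [hp : Fact p.Prime] [CharP k p]
  {G Q X Y : Type*} [Group G] [Group Q] [Fintype G] [Fintype Q] [MulAction Q X]
  [SpaceWithFunctions k X] [SpaceWithFunctions k Y] {π : X → Y}

theorem exists_pow_sub_sub_eq (k : Type*) [Field k] [IsAlgClosed k] {p : ℕ} (hp : 1 < p)
    (a b : k) : ∃ t : k, t ^ p - t - a = b := by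
  have hdeg : (Polynomial.X ^ p - Polynomial.X - Polynomial.C (a + b) : Polynomial k).natDegree
      = p := by
    rw [Polynomial.natDegree_sub_C, FiniteField.X_pow_card_sub_X_natDegree_eq k hp]
  obtain ⟨t, ht⟩ := IsAlgClosed.exists_root
    (Polynomial.X ^ p - Polynomial.X - Polynomial.C (a + b) : Polynomial k) fun h => by
      rw [Polynomial.natDegree_eq_of_degree_eq_some (n := 0) h] at hdeg
      omega
  refine ⟨t, ?_⟩
  simp only [Polynomial.IsRoot, Polynomial.eval_sub, Polynomial.eval_pow, Polynomial.eval_X,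
    Polynomial.eval_C] at ht
  linear_combination ht

/-- The fixed points of Frobenius form the prime field. This shows that two points of one fibre of
`θ` differ by an element of `ZMod p`. -/
theorem exists_zmod_of_pow_eq {k : Type*} [Field k] {p : ℕ} [Fact p.Prime] [CharP k p] {y : k} (hy : y ^ p = y) :
    ∃ z : ZMod p, ZMod.castHom (dvd_refl p) k z = y := by
  have h : y ∈ (⊥ : Subfield k) := (Subfield.mem_bot_iff_pow_eq_self k p).2 hy
  exact (bot_le : ⊥ ≤ (ZMod.castHom (dvd_refl p) k).fieldRange) h

/-- A Galois quotient of `X` by `Q` yields one of `X × k` by a central extension of `Q`. -/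
theorem IsGaloisQuotient.exists_centralExtension (h : IsGaloisQuotient k Q π)
    (E : CentralExtension p G Q) :
    ∃ (_ : MulAction G (X × AffSpace k 1)) (π' : X × AffSpace k 1 → Y × AffSpace k 1),
      IsGaloisQuotient k G π' := by
  obtain ⟨c, hc, hmul, hincl⟩ := h.exists_cocycle E
  have hp2 := hp.out.two_le
  obtain ⟨v, hv, hv1⟩ := h.exists_coboundary E (fun g x => c g x ^ p - c g x)
    (fun g => sub_mem (pow_mem (hc g) p) (hc g))
    (fun g g' x => by simp only [hmul, add_pow_char]; ring)
    (fun z x => by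
      simp only [hincl]; rw [← map_pow, ZMod.pow_card, sub_self])
  let act := twistedAction E.proj c hmul
  have hsmul : ∀ (g : G) (z : X × AffSpace k 1),
      g • z = (E.proj g • z.1, fun _ => z.2 0 + c g z.1) := fun _ _ => rfl
  let θ : X × AffSpace k 1 → k := fun z => z.2 0 ^ p - z.2 0 - v z.1
  have hθ : ∀ (g : G) z, θ (g • z) = θ z := fun g z => by
    simp only [θ, hsmul, hv1, add_pow_char]; ring
  have hcoord : (fun z : X × AffSpace k 1 => z.2 0) ∈
      regular (k := k) (X := X × AffSpace k 1) := isMorphism_snd _ (coord_mem_regular k 0)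
  have hfst : ∀ f ∈ regular (k := k) (X := X), (fun z : X × AffSpace k 1 => f z.1) ∈
      regular (k := k) (X := X × AffSpace k 1) := fun f hf => isMorphism_fst f hf
  have hθreg : θ ∈ regular (k := k) (X := X × AffSpace k 1) :=
    sub_mem (sub_mem (pow_mem hcoord p) hcoord) (hfst v hv)
  -- Enumerate `G` as `sec q * incl t`; the inner sum runs over translates of the last coordinate by
  -- `ZMod p`.
  have hsum : ∀ (f : X × AffSpace k 1 → k) z, ∑ g : G, f (g • z) = ∑ q : Q, ∑ t : ZMod p,
      f (q • z.1, fun _ => z.2 0 + c (E.sec q) z.1 + ZMod.castHom (dvd_refl p) k t) := by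
    intro f z
    rw [← Fintype.sum_prod_type', ← E.equiv.sum_comp]
    refine Finset.sum_congr rfl fun x _ => ?_
    change f ((E.sec x.1 * E.incl x.2) • z) = _
    rw [hsmul, map_mul, E.proj_section, E.proj_incl, mul_one, hmul, hincl, E.proj_incl, one_smul,
      add_assoc]
  have hsum_pow : ∀ (a : X → k) (i : ℕ), i < p → ∀ z : X × AffSpace k 1,
      ∑ g : G, (fun z : X × AffSpace k 1 => a z.1 * z.2 0 ^ i) (g • z) =
        (∑ q : Q, a (q • z.1)) * if i = p - 1 then -1 else 0 := by
    intro a i hi z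
    rw [hsum fun z : X × AffSpace k 1 => a z.1 * z.2 0 ^ i, Finset.sum_mul]
    refine Finset.sum_congr rfl fun q _ => ?_
    simp only
    rw [← Finset.mul_sum, sum_add_zmod_pow p _ hi]
  refine ⟨act, fun z => (π z.1, fun _ => θ z), ?_, ?_, ?_, ?_, ?_, ?_, ?_⟩
  · intro g
    change IsMorphism k fun z : X × AffSpace k 1 =>
      (E.proj g • z.1, fun _ => z.2 0 + c g z.1)
    exact ((h.isRegularAction (E.proj g)).comp isMorphism_fst).prodMk
      (isMorphism_affSpace fun _ => add_mem hcoord (hfst _ (hc g)))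
  · intro g z hz
    rw [hsmul] at hz
    have h1 : E.proj g = 1 := h.isFreeAction _ z.1 (congrArg Prod.fst hz)
    have h2 : z.2 0 + c g z.1 = z.2 0 := congrFun (congrArg Prod.snd hz) 0
    obtain ⟨t, rfl⟩ := E.exists_incl_eq g h1
    rw [hincl, add_eq_left, map_eq_zero] at h2
    rw [h2, E.incl_zero]
  · rintro ⟨y, s⟩
    obtain ⟨x, rfl⟩ := h.surjective y
    obtain ⟨t, ht⟩ : ∃ t : k, t ^ p - t - v x = s 0 :=
      exists_pow_sub_sub_eq k hp.out.one_lt _ _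
    refine ⟨(x, fun _ => t), ?_⟩
    ext i
    · rfl
    · rw [Subsingleton.elim i 0]; exact ht
  · rintro ⟨x, t⟩ ⟨x', t'⟩
    constructor
    · intro hxt
      obtain ⟨q, rfl⟩ := (h.eq_iff _ _).1 (congrArg Prod.fst hxt)
      have h1 : θ (x, t) = θ (q • x, t') := congrFun (congrArg Prod.snd hxt) 0
      rw [← hθ (E.sec q), hsmul, E.proj_section] at h1
      simp only [θ] at h1
      obtain ⟨z, hz⟩ := exists_zmod_of_pow_eq (p := p) (y := t' 0 - (t 0 + c (E.sec q) x)) (by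
        rw [sub_pow_char]; linear_combination -h1)
      refine ⟨E.sec q * E.incl z, ?_⟩
      rw [hsmul, map_mul, E.proj_section, E.proj_incl, mul_one]
      ext i
      · rfl
      · rw [Subsingleton.elim i 0]
        simp only [hmul, hincl, E.proj_incl, one_smul, hz]
        ring
    · rintro ⟨g, hg⟩
      rw [← hg]
      ext i
      · exact (h.map_smul (E.proj g) x).symm
      · exact (hθ g _).symm
  · exact (h.isMorphism.comp isMorphism_fst).prodMk (isMorphism_affSpace fun _ => hθreg)
  · obtain ⟨w, hw, hw1⟩ := h.exists_trace_eq_one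
    -- The sign cancels the -1 from the power sum of degree `p - 1`.
    refine ⟨fun z => -w z.1 * z.2 0 ^ (p - 1),
      mul_mem (neg_mem (hfst w hw)) (pow_mem hcoord _), fun z => ?_⟩
    rw [hsum_pow (fun x => -w x) (p - 1) (by omega) z]
    simp [hw1]
  · have hpow : ∀ (i : ℕ), ∀ a ∈ regular (k := k) (X := X),
        ∃ F ∈ regular (k := k) (X := Y × AffSpace k 1), ∀ z : X × AffSpace k 1,
          ∑ g : G, (fun z : X × AffSpace k 1 => a z.1 * z.2 0 ^ i) (g • z) =
            F (π z.1, fun _ => θ z) := by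
      intro i
      induction i using Nat.strong_induction_on with
      | _ i ih =>
        intro a ha
        by_cases hi : i < p
        · obtain ⟨F, hF, hF'⟩ := h.exists_trace_eq a ha
          refine ⟨_, mul_mem (isMorphism_fst F hF) (const_mem_regular _ (if i = p - 1 then -1 else 0)),
            fun z => ?_⟩
          rw [hsum_pow a i hi z, hF']
          rfl
        · obtain ⟨j, rfl⟩ : ∃ j, i = j + p := ⟨i - p, by omega⟩
          obtain ⟨F₁, hF₁, h₁⟩ := ih j (by omega) a ha
          obtain ⟨F₂, hF₂, h₂⟩ := ih (j + 1) (by omega) a ha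
          obtain ⟨F₃, hF₃, h₃⟩ := ih j (by omega) _ (mul_mem ha hv)
          -- Substitute `t ^ p = θ + t + v` in `a * t ^ (j + p)`. The invariant `θ` leaves the trace
          -- as the last coordinate on `Y × k`, and `v` is absorbed into the coefficient `a`.
          refine ⟨_, add_mem (add_mem (mul_mem (isMorphism_snd _ (coord_mem_regular k 0)) hF₁) hF₂)
            hF₃, fun z => ?_⟩
          simp only [Pi.add_apply, Pi.mul_apply, Function.comp_apply, ← h₁, ← h₂, ← h₃]
          rw [Finset.mul_sum, ← Finset.sum_add_distrib, ← Finset.sum_add_distrib]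
          refine Finset.sum_congr rfl fun g _ => ?_
          rw [← hθ g z]
          simp only [θ]
          ring
    have hadd : ∀ f f' : X × AffSpace k 1 → k,
        (∃ F ∈ regular (k := k) (X := Y × AffSpace k 1), ∀ z : X × AffSpace k 1,
          ∑ g : G, f (g • z) = F (π z.1, fun _ => θ z)) →
        (∃ F ∈ regular (k := k) (X := Y × AffSpace k 1), ∀ z : X × AffSpace k 1,
          ∑ g : G, f' (g • z) = F (π z.1, fun _ => θ z)) →
        (∃ F ∈ regular (k := k) (X := Y × AffSpace k 1), ∀ z : X × AffSpace k 1,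
          ∑ g : G, (f + f') (g • z) = F (π z.1, fun _ => θ z)) := by
      rintro f f' ⟨F, hF, h₁⟩ ⟨F', hF', h₂⟩
      exact ⟨_, add_mem hF hF', fun z => by simp [Finset.sum_add_distrib, h₁, h₂]⟩
    intro f hf
    refine regular_prod_induction (P := fun f : X × AffSpace k 1 → k =>
      ∃ F ∈ regular (k := k) (X := Y × AffSpace k 1), ∀ z : X × AffSpace k 1,
          ∑ g : G, f (g • z) = F (π z.1, fun _ => θ z)) (fun a ha b hb => ?_) hadd hf
    refine regular_affSpace_one_induction (P := fun b : AffSpace k 1 → k =>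
      ∃ F ∈ regular (k := k) (X := Y × AffSpace k 1), ∀ z : X × AffSpace k 1,
          ∑ g : G, (fun z : X × AffSpace k 1 => a z.1 * b z.2) (g • z) =
            F (π z.1, fun _ => θ z)) (fun r i => ?_) (fun b b' hb hb' => ?_) hb
    · obtain ⟨F, hF, hF'⟩ := hpow i _ (mul_mem ha (const_mem_regular X r))
      refine ⟨F, hF, fun z => ?_⟩
      rw [← hF']
      refine Finset.sum_congr rfl fun g _ => ?_
      simp only [Pi.mul_apply]; ring
    · convert hadd (fun z => a z.1 * b z.2) (fun z => a z.1 * b' z.2) hb hb' using 6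
      simp only [Pi.add_apply]; ring

end Step

/-! ### Induction on the order of the group, and the theorem -/

/-- Transport of an action along a bijection. -/
@[reducible] def pullbackAction {G X X' : Type*} [Group G] [MulAction G X] (e : X' ≃ X) :
    MulAction G X' where
  smul g x := e.symm (g • e x)
  one_smul x := by
    change e.symm ((1 : G) • e x) = x
    simp
  mul_smul g g' x := by
    change e.symm ((g * g') • e x) = e.symm (g • e (e.symm (g' • e x)))
    simp [mul_smul]

/-- The trivial action. -/
@[reducible] def trivialAction (G X : Type*) [Group G] : MulAction G X where
  smul _ x := x
  one_smul _ := rfl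
  mul_smul _ _ _ := rfl

theorem IsGaloisQuotient.exists_pullback {k G X Y X' Y' : Type*} [CommSemiring k] [Group G]
    [Fintype G] [MulAction G X] [SpaceWithFunctions k X] [SpaceWithFunctions k Y]
    [SpaceWithFunctions k X'] [SpaceWithFunctions k Y'] {π : X → Y} (h : IsGaloisQuotient k G π)
    (e : Iso k X' X) (e' : Iso k Y Y') :
    ∃ (_ : MulAction G X') (π' : X' → Y'), IsGaloisQuotient k G π' ∧
      ∀ (g : G) (x : X'), e.toEquiv (g • x) = g • e.toEquiv x := by
  let act : MulAction G X' := pullbackAction e.toEquiv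
  have he : ∀ (g : G) (x : X'), e.toEquiv (g • x) = g • e.toEquiv x :=
    fun g x => e.toEquiv.apply_symm_apply _
  exact ⟨act, _, h.transport e e' he, he⟩

/-- A group of order `p ^ n` acts freely on `k^n` with quotient `k^n`. -/
theorem exists_isGaloisQuotient_affSpace (k : Type*) [Field k] [IsAlgClosed k] (p : ℕ)
    [hp : Fact p.Prime] [CharP k p] (n : ℕ) (G : Type*) [Group G] [Fintype G]
    (hG : Nat.card G = p ^ n) :
    ∃ (_ : MulAction G (AffSpace k n)) (π : AffSpace k n → AffSpace k n),
      IsGaloisQuotient k G π := by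
  induction n generalizing G with
  | zero =>
    rw [pow_zero, Nat.card_eq_one_iff_unique] at hG
    obtain ⟨_, _⟩ := hG
    have hsum : ∀ F : G → k, ∑ g, F g = F 1 := fun F =>
      Fintype.sum_eq_single 1 fun g hg => absurd (Subsingleton.elim g 1) hg
    let act : MulAction G (AffSpace k 0) := trivialAction G _
    refine ⟨act, id, fun _ => isMorphism_id, fun g _ _ => Subsingleton.elim g 1,
      Function.surjective_id, fun x y => ⟨fun _ => ⟨1, Subsingleton.elim _ _⟩,
        fun _ => Subsingleton.elim _ _⟩, isMorphism_id,
      ⟨1, one_mem _, fun x => ?_⟩, fun f hf => ⟨f, hf, fun x => ?_⟩⟩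
    · exact hsum fun _ => 1
    · exact hsum fun _ => f x
  | succ n ih =>
    obtain ⟨N, _, hcard, ⟨E⟩⟩ := exists_centralExtension p n G hG
    have : Fintype (G ⧸ N) := Fintype.ofFinite _
    obtain ⟨_, π, h⟩ := ih (G ⧸ N) hcard
    obtain ⟨_, π', h'⟩ := h.exists_centralExtension E
    obtain ⟨act, π'', h'', -⟩ := h'.exists_pullback (affSpaceProdIso k (rfl : n + 1 = n + 1))
      (affSpaceProdIso k rfl).symm
    exact ⟨act, π'', h''⟩

end SpaceWithFunctions

theorem theorem0p2 {k : Type*} [Field k] [IsAlgClosed k] (p n : ℕ) [Fact p.Prime] [CharP k p]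
    (G : Type*) [Group G] (hG : Nat.card G = p ^ n) :
    ∃ _ : MulAction G (SpaceWithFunctions.AffSpace k (Nat.card G - 1)),
      SpaceWithFunctions.IsRegularAction k G
        (SpaceWithFunctions.AffSpace k (Nat.card G - 1)) ∧
      SpaceWithFunctions.IsFreeAction G (SpaceWithFunctions.AffSpace k (Nat.card G - 1)) ∧
      Nonempty (SpaceWithFunctions.Iso k
        (MulAction.orbitRel.Quotient G (SpaceWithFunctions.AffSpace k (Nat.card G - 1)))
        (SpaceWithFunctions.AffSpace k (Nat.card G - 1))) ∧
      ∃ _ : MulAction G (SpaceWithFunctions.AffSpace k n),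
      ∃ _ : MulAction G (SpaceWithFunctions.AffSpace k (Nat.card G - n - 1)),
        SpaceWithFunctions.IsRegularAction k G (SpaceWithFunctions.AffSpace k n) ∧
        SpaceWithFunctions.IsFreeAction G (SpaceWithFunctions.AffSpace k n) ∧
        (∀ (g : G) (c : SpaceWithFunctions.AffSpace k (Nat.card G - n - 1)), g • c = c) ∧
        (∃ e : SpaceWithFunctions.Iso k (SpaceWithFunctions.AffSpace k (Nat.card G - 1))
            (SpaceWithFunctions.AffSpace k n ×
              SpaceWithFunctions.AffSpace k (Nat.card G - n - 1)),
          ∀ (g : G) (a : SpaceWithFunctions.AffSpace k (Nat.card G - 1)),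
            e.toEquiv (g • a) = g • e.toEquiv a) ∧
        Nonempty (SpaceWithFunctions.Iso k
          (MulAction.orbitRel.Quotient G (SpaceWithFunctions.AffSpace k n))
          (SpaceWithFunctions.AffSpace k n)) := by
  have : Fintype G := @Fintype.ofFinite G (Nat.finite_of_card_ne_zero (by
    rw [hG]; exact pow_ne_zero _ (Fact.out : p.Prime).ne_zero))
  -- Ensures that the truncated subtraction in the dimension of `C` is a true one.
  have hlt : n < Nat.card G := hG ▸ Nat.lt_pow_self (Fact.out : p.Prime).one_lt
  have hN : n + (Nat.card G - n - 1) = Nat.card G - 1 := by omega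
  obtain ⟨actB, πB, hB⟩ := SpaceWithFunctions.exists_isGaloisQuotient_affSpace k p n G hG
  let actC : MulAction G (SpaceWithFunctions.AffSpace k (Nat.card G - n - 1)) :=
    SpaceWithFunctions.trivialAction G _
  have hC : ∀ (g : G) (c : SpaceWithFunctions.AffSpace k (Nat.card G - n - 1)), g • c = c :=
    fun _ _ => rfl
  obtain ⟨actA, πA, hA, he⟩ := (hB.prod_trivial hC).exists_pullback
    (SpaceWithFunctions.affSpaceProdIso k hN) (SpaceWithFunctions.affSpaceProdIso k hN).symm
  exact ⟨actA, hA.isRegularAction, hA.isFreeAction, hA.nonempty_iso, actB, actC,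
    hB.isRegularAction, hB.isFreeAction, hC, ⟨_, he⟩, hB.nonempty_iso⟩
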